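/- Let $S=\mathrm{PG}(d,\mathbb{F}_q)$ be the projective space whose points are the one-dimensional subspaces of $\mathbb{F}_q^{d+1}$, and whose lines are the sets of points contained in a fixed two-dimensional subspace. For a bijection $f$ from the points of $S$ to a set $P$, let $f(S)$ be the space on the point set $P$ whose lines are the images under $f$ of the lines of $S$; the spaces $\mathrm{PG}(d,\mathbb{F}_q)$ on $P$ are those of this form. Two such spaces on the same point set are orthogoval if each line of one meets each line of the other in at most two points. A set of spaces is mutually orthogoval if any two distinct members are orthogoval. Let $z$ be a primitive element of $\mathbb{F}_{q^{d+1}}$ (a generator of its multiplicative group), and give the point $(x_1:\dots:x_{d+1})$ of $S$ the labels $a\sum_{i=1}^{d+1} x_i z^i$ with $a\in\mathbb{F}_q^{*}$. For $m$ relatively prime to $q^{d+1}-1$, the map $x\mapsto x^m$ on labels induces a bijection $\Phi_m$ of the points of $S$. **Theorem.** There exist sets of 6 mutually orthogoval $\mathrm{PG}(4,\mathbb{F}_2)$, 18 mutually orthogoval $\mathrm{PG}(6,\mathbb{F}_2)$, 10 mutually orthogoval $\mathrm{PG}(4,\mathbb{F}_3)$, 78 mutually orthogoval $\mathrm{PG}(6,\mathbb{F}_3)$,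 3 mutually orthogoval $\mathrm{PG}(4,\mathbb{F}_4)$, 11 mutually orthogoval $\mathrm{PG}(6,\mathbb{F}_4)$, and 7 mutually orthogoval $\mathrm{PG}(4,\mathbb{F}_5)$. In each case, with $N$ the stated size, the set can be chosen of the form $\{\Phi_{w^i}(S) : 0\le i\le N-1\}$ for some primitive element $z$ and some positive integer $w$ relatively prime to $q^{d+1}-1$. -/

import Mathlib

open scoped LinearAlgebra.Projectivization

namespace Orthogoval

/-- The point set of `PG(d, F)`: the one-dimensional subspaces of `F ^ (d + 1)`. -/
abbrev PGPoint (d : ℕ) (F : Type*) [Field F] : Type _ := ℙ F (Fin (d + 1) → F)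

/-- The lines of the standard `PG(d, F)`, as sets of points: each two-dimensional subspace `W`
of `F ^ (d + 1)` gives the line of all points contained in `W`. -/
def standardLines (d : ℕ) (F : Type*) [Field F] : Set (Set (PGPoint d F)) :=
  {l | ∃ W : Submodule F (Fin (d + 1) → F), Module.finrank F W = 2 ∧
    l = {x : PGPoint d F | x.submodule ≤ W}}

/-- The line set of the space `f(PG(d, F))` that a bijection `f` from the standard point set to `P`
induces on `P`: its lines are the images under `f` of the standard lines. -/
def inducedLines {d : ℕ} {F : Type*} [Field F] {P : Type*} (f : PGPoint d F ≃ P) :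
    Set (Set P) :=
  {l | ∃ m ∈ standardLines d F, l = f '' m}

/-- `L` is the line set of a projective space isomorphic to `PG(d, F)` on the point set `P`. -/
def IsProjectiveSpace (d : ℕ) (F : Type*) [Field F] {P : Type*} (L : Set (Set P)) : Prop :=
  ∃ f : PGPoint d F ≃ P, L = inducedLines f

/-- Two spaces on the point set `P`, given by their line sets, are orthogoval: each line of
one meets each line of the other in at most two points. -/
def AreOrthogoval {P : Type*} (L M : Set (Set P)) : Prop :=
  ∀ l ∈ L, ∀ m ∈ M, (l ∩ m).encard ≤ 2

/-- `𝒮` is a set of `N` mutually orthogoval spaces `PG(d, F)` on the point set `P`. -/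
def IsMutuallyOrthogovalSet (d : ℕ) (F : Type*) [Field F] {P : Type*} (N : ℕ)
    (𝒮 : Set (Set (Set P))) : Prop :=
  𝒮.Finite ∧ 𝒮.ncard = N ∧ (∀ L ∈ 𝒮, IsProjectiveSpace d F L) ∧ 𝒮.Pairwise AreOrthogoval

/-- The label `∑ i ∈ {1, …, d + 1}, x_i z ^ i` of a coordinate vector. -/
def label {d : ℕ} {F E : Type*} [Field F] [Field E] [Algebra F E] (z : E)
    (x : Fin (d + 1) → F) : E :=
  ∑ i : Fin (d + 1), x i • z ^ ((i : ℕ) + 1)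

/-- The bijection `f` of the points of `PG(d, F)` is the map induced by `x ↦ x ^ m` on labels:
it sends the point with label `x` to the point with label `x ^ m`. -/
def IsPowerMap {d : ℕ} {F E : Type*} [Field F] [Field E] [Algebra F E] (z : E) (m : ℕ)
    (f : PGPoint d F ≃ PGPoint d F) : Prop :=
  ∀ (x y : Fin (d + 1) → F) (hx : x ≠ 0) (hy : y ≠ 0),
    label z y = label z x ^ m → f (Projectivization.mk F x hx) = Projectivization.mk F y hy

/-- `𝒮` consists of the spaces induced by the power maps with exponents
`w ^ 0, w ^ 1, …, w ^ (N - 1)`, where the points of `PG(d, F)` are labelled through some primitive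
element `z` of a field extension `E` of `F` of degree `d + 1`. -/
def IsPowerMapFamily.{u} (d : ℕ) (F : Type u) [Field F] (N w : ℕ)
    (𝒮 : Set (Set (Set (PGPoint d F)))) : Prop :=
  ∃ (E : Type u) (_ : Field E) (_ : Algebra F E) (z : E),
    Module.finrank F E = d + 1 ∧ IsPrimitiveRoot z (Nat.card E - 1) ∧
    ∃ f : Fin N → (PGPoint d F ≃ PGPoint d F),
      (∀ i : Fin N, IsPowerMap z (w ^ (i : ℕ)) (f i)) ∧
      𝒮 = Set.range fun i => inducedLines (f i)

/-- There is a set of `N` mutually orthogoval `PG(d, F)`, induced by the powers of one power map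
`Φ_w`, with `w` relatively prime to the order of the multiplicative group of the extension field of
degree `d + 1`. -/
def HasMutuallyOrthogovalPG (d : ℕ) (F : Type*) [Field F] (N : ℕ) : Prop :=
  ∃ 𝒮 : Set (Set (Set (PGPoint d F))), IsMutuallyOrthogovalSet d F N 𝒮 ∧
    ∃ w : ℕ, w.Coprime (Nat.card F ^ (d + 1) - 1) ∧ IsPowerMapFamily d F N w 𝒮

end Orthogoval

/-! The points of the space are the elements of E^*/F^*, where E has degree d + 1 over F. Suppose
that a line of Φ_m(S) and a line of Φ_{mn}(S) share three points. As Φ_m is injective on points,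
undoing it gives three collinear points with collinear images under x ↦ x^n. Scaling turns the three
points into 1, y, 1 + y with y ∉ F. So the two spaces are orthogoval once (1 + y)^n = a + b y^n has
no solution with a, b ∈ F^* (`PreservesNoTriple`, `areOrthogoval_of_preservesNoTriple`). For
exponents w^i with i < N, only n = w^k with 1 ≤ k < N matter. Members with different i are distinct
because no space is orthogoval to itself.

Absence of solutions is a finite check on exponents. Let 1 + z^t = z^{Z(t)} (Zech logarithm), and
let M be the number of points, so that the scalars are the powers of z^M. With y = z^t the equation
becomes n Z(t) ≡ Z(n t + c M) modulo M for some c. Frobenius permutes the solutions y, so one t per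
orbit suffices.

The kernel evaluates this on tables packed into single natural numbers. Nothing is proved about how
the tables are built: `checkTables` certifies the result, and `exists_isZechRoot` finds, in any
field of the right order, a primitive element that certified tables describe. -/

namespace Orthogoval

/-! ### Kernel-friendly arithmetic in finite fields -/

/-- `f n`, arranged so that the kernel evaluates `n` before it enters `f`. -/
def force {α : Type} (n : ℕ) (f : ℕ → α) : α :=
  -- The recursor makes the kernel reduce its last argument to a numeral; the successor lets it
  -- reduce on a variable too, so that `force_eq` is `rfl`.
  Nat.rec (motive := fun _ => α) (f 0) (fun k _ => f k) (Nat.succ n)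

/-- `2 ^ k`-fold iteration of `step`. -/
def iterPow (step : ℕ → ℕ) (k : ℕ) : ℕ → ℕ :=
  Nat.rec (motive := fun _ => ℕ → ℕ) step (fun _ ih a => force (ih a) ih) k

/-- The sum of `f t` over `lo ≤ t < lo + 2 ^ k`. -/
def sumBlock (f : ℕ → ℕ) (k : ℕ) : ℕ → ℕ :=
  Nat.rec (motive := fun _ => ℕ → ℕ) f
    (fun k ih lo => Nat.add (ih lo) (force (Nat.add lo (Nat.pow 2 k)) ih)) k

/-- Whether `P t` holds for all `lo ≤ t < lo + 2 ^ k`. -/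
def allBlock (P : ℕ → Bool) (k : ℕ) : ℕ → Bool :=
  Nat.rec (motive := fun _ => ℕ → Bool) P
    (fun k ih lo => ih lo && force (Nat.add lo (Nat.pow 2 k)) ih) k

/-- Whether `P i` holds for all `i < n`. -/
def allBelow (P : ℕ → Bool) (n : ℕ) : Bool :=
  Nat.rec (motive := fun _ => Bool) true (fun k ih => P k && ih) n

/-- Digitwise `a + c * b` modulo `p`, on the lowest `n` base `p` digits. -/
def axpy (p c n : ℕ) : ℕ → ℕ → ℕ :=
  Nat.rec (motive := fun _ => ℕ → ℕ → ℕ) (fun a _ => a)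
    (fun _ ih a b => Nat.add (Nat.mod (Nat.add a (Nat.mul c b)) p)
      (Nat.mul p (force (Nat.div a p) fun a' => force (Nat.div b p) fun b' => ih a' b'))) n

/-- The data of a finite field of order `p ^ deg` with a primitive element `z`: the base `p` digits
of `red`, which has at most `redLen` of them, are the coefficients of `z ^ deg`; tables have
`2 ^ width` entries of `width` bits, and `half` is the logarithm of `-1`. -/
structure FieldData where
  p : ℕ
  deg : ℕ
  red : ℕ
  redLen : ℕ
  width : ℕ
  half : ℕ

namespace FieldData

variable (D : FieldData)

/-- The order of the multiplicative group. -/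
def order : ℕ := Nat.sub (Nat.pow D.p D.deg) 1

/-- Multiplication by the primitive element. -/
def mulRoot (a : ℕ) : ℕ :=
  force (Nat.mul D.p a) fun a' => force (Nat.div a' (Nat.pow D.p D.deg)) fun c =>
    bif Nat.beq c 0 then a' else
      axpy D.p c D.redLen (Nat.sub a' (Nat.mul c (Nat.pow D.p D.deg))) D.red

/-- Addition of one. -/
def addOne (a : ℕ) : ℕ :=
  Nat.add (Nat.mul D.p (Nat.div a D.p)) (Nat.mod (Nat.succ a) D.p)

/-- Lookup in a table of powers, which is stored in descending order. -/
def getPow (T t : ℕ) : ℕ :=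
  Nat.mod (Nat.shiftRight T (Nat.mul D.width (Nat.sub (Nat.pow 2 D.width) t))) (Nat.pow 2 D.width)

/-- Lookup in a table of logarithms. -/
def getLog (L a : ℕ) : ℕ :=
  Nat.mod (Nat.shiftRight L (Nat.mul D.width a)) (Nat.pow 2 D.width)

/-- The table of the powers of the primitive element. -/
def powTable : ℕ :=
  iterPow (fun T => Nat.add (Nat.shiftLeft T D.width) (D.mulRoot (Nat.mod T (Nat.pow 2 D.width))))
    D.width 1

/-- The table of the logarithms, given the table of powers. -/
def logTable (T : ℕ) : ℕ :=
  sumBlock (fun t => bif Nat.ble D.order t then 0 else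
    Nat.shiftLeft t (Nat.mul D.width (D.getPow T t))) D.width 0

/-- The Zech logarithm of `t`, from the tables of powers and logarithms. -/
def zech (T L t : ℕ) : ℕ := D.getLog L (D.addOne (D.getPow T t))

/-- The tables belong to a field with a primitive element. -/
def checkTables (T L : ℕ) : Bool :=
  Nat.ble 1 D.deg && Nat.ble D.redLen D.deg && Nat.ble (Nat.succ D.red) (Nat.pow D.p D.redLen) &&
  Nat.ble (Nat.succ D.half) D.order && Nat.beq (D.getPow T 0) 1 && Nat.beq (D.getPow T D.order) 1 &&
  Nat.ble D.order (Nat.pow 2 D.width) && Nat.beq (D.addOne (D.getPow T D.half)) 0 &&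
  allBlock (fun t => Nat.ble D.order t || force (D.getPow T t) fun a =>
    Nat.ble a D.order && Nat.beq (D.getPow T (Nat.succ t)) (D.mulRoot a) &&
    -- At `half` the sum `1 + z ^ t` is zero and has no logarithm.
    (Nat.beq t D.half || force (D.addOne a) fun b => force (D.getLog L b) fun u =>
      Nat.ble u D.order && Nat.beq (D.getPow T u) b)) D.width 0

/-- No point of the line through the points `1` and `z ^ (m * t)` is the point `z ^ (m * u)`, where
`N` is the number of points and `r` the number of nonzero scalars. -/
def checkTriple (T L N r m t u : ℕ) : Bool :=
  force (Nat.mod (Nat.mul m u) N) fun v =>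
    allBelow (fun c => force (Nat.mod (Nat.add (Nat.mul m t) (Nat.mul c N)) D.order) fun i =>
      -- For `i = half` the combination is the zero vector, which is no point.
      Nat.beq i D.half || !Nat.beq (Nat.mod (D.zech T L i) N) v) r

/-- `checkTriple` for the exponents `m * w ^ k` with `1 ≤ k ≤ n`. -/
def checkPowers (T L N r w t u n : ℕ) : ℕ → Bool :=
  Nat.rec (motive := fun _ => ℕ → Bool) (fun _ => true)
    (fun _ ih m => force (Nat.mod (Nat.mul m w) D.order) fun m' =>
      D.checkTriple T L N r m' t u && ih m') n

/-- For `1 ≤ k ≤ n`, the power map with exponent `w ^ k` takes no three collinear points to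
collinear points, tested on one representative `t` of each Frobenius orbit. -/
def checkExponent (T L N r w n : ℕ) : Bool :=
  allBlock (fun t => Nat.ble D.order t || Nat.beq (Nat.mod t N) 0 ||
    !allBelow (fun j => Nat.ble t (Nat.mod (Nat.mul (Nat.pow D.p j) t) D.order)) D.deg ||
    force (D.zech T L t) fun u => D.checkPowers T L N r w t u n 1) D.width 0

/-- The complete test for `n + 1` mutually orthogoval spaces over the field with `r + 1`
elements. -/
def check (N r w n : ℕ) : Bool :=
  force D.powTable fun T => force (D.logTable T) fun L =>
    D.checkTables T L && D.checkExponent T L N r w n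

end FieldData

theorem force_eq {α : Type} (n : ℕ) (f : ℕ → α) : force n f = f n := rfl

theorem forall_of_allBlock {P : ℕ → Bool} {k lo : ℕ} (h : allBlock P k lo = true) :
    ∀ t, lo ≤ t → t < lo + 2 ^ k → P t = true := by
  induction k generalizing lo with
  | zero =>
    intro t h1 h2
    obtain rfl : t = lo := by simp at h2; omega
    exact h
  | succ k ih =>
    have h' : (allBlock P k lo && allBlock P k (lo + 2 ^ k)) = true := h
    rw [Bool.and_eq_true] at h'
    intro t h1 h2
    rw [pow_succ] at h2
    by_cases ht : t < lo + 2 ^ k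
    · exact ih h'.1 t h1 ht
    · exact ih h'.2 t (by omega) (by omega)

theorem allBelow_eq_true_iff {P : ℕ → Bool} {n : ℕ} :
    allBelow P n = true ↔ ∀ i < n, P i = true := by
  induction n with
  | zero => simp [allBelow]
  | succ n ih =>
    have h : allBelow P (n + 1) = (P n && allBelow P n) := rfl
    rw [h, Bool.and_eq_true, ih]
    exact ⟨fun h i hi => (Nat.lt_succ_iff_lt_or_eq.1 hi).elim (h.2 i) (fun e => e ▸ h.1),
      fun h => ⟨h n (by omega), fun i hi => h i (by omega)⟩⟩

/-! ### Polynomials coded by base `p` digits -/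

section DigitValue

variable {R : Type*} [CommRing R] {p : ℕ} (x : R)

/-- The value at `x` of the polynomial whose coefficients are the base `p` digits of `a`. -/
noncomputable def digitValue (p : ℕ) (x : R) (a : ℕ) : R := Nat.ofDigits x (Nat.digits p a)

theorem digitValue_zero : digitValue p x 0 = 0 := by
  rw [digitValue, Nat.digits_zero]
  rfl

theorem digitValue_eq (hp : 1 < p) (a : ℕ) :
    digitValue p x a = ((a % p : ℕ) : R) + x * digitValue p x (a / p) := by
  rcases Nat.eq_zero_or_pos a with rfl | ha
  · simp [digitValue_zero]
  · rw [digitValue, Nat.digits_def' hp ha]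
    rfl

theorem digitValue_add_mul (hp : 1 < p) {d : ℕ} (hd : d < p) (a : ℕ) :
    digitValue p x (d + p * a) = d + x * digitValue p x a := by
  rw [digitValue_eq x hp, Nat.add_mul_mod_self_left, Nat.mod_eq_of_lt hd,
    Nat.add_mul_div_left _ _ (by omega), Nat.div_eq_of_lt hd, zero_add]

theorem digitValue_of_lt (hp : 1 < p) {d : ℕ} (hd : d < p) : digitValue p x d = d := by
  simpa [digitValue_zero] using digitValue_add_mul x hp hd 0

theorem digitValue_base_mul (hp : 1 < p) (a : ℕ) :
    digitValue p x (p * a) = x * digitValue p x a := by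
  simpa using digitValue_add_mul x hp (d := 0) (by omega) a

theorem digitValue_eq_mod_add_div (hp : 1 < p) (n a : ℕ) :
    digitValue p x a = digitValue p x (a % p ^ n) + x ^ n * digitValue p x (a / p ^ n) := by
  induction n generalizing a with
  | zero => simp [Nat.mod_one, digitValue_zero]
  | succ n ih =>
    have h1 : a % p ^ (n + 1) = a % p + p * (a / p % p ^ n) := by
      rw [pow_succ', Nat.mod_mul]
    rw [h1, digitValue_add_mul x hp (Nat.mod_lt _ (by omega)), digitValue_eq x hp a, ih (a / p),
      Nat.div_div_eq_div_mul, ← pow_succ']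
    ring

theorem cast_mod_of_cast_eq_zero (h0 : (p : R) = 0) (a : ℕ) : ((a % p : ℕ) : R) = a := by
  conv_rhs => rw [← Nat.mod_add_div a p]
  simp [h0]

theorem digitValue_axpy (hp : 1 < p) (h0 : (p : R) = 0) (c : ℕ) {n : ℕ} (a : ℕ) {b : ℕ}
    (hb : b < p ^ n) :
    digitValue p x (axpy p c n a b) = digitValue p x a + c * digitValue p x b := by
  induction n generalizing a b with
  | zero =>
    obtain rfl : b = 0 := by simpa using hb
    simp [axpy, digitValue_zero]
  | succ n ih =>
    have h : axpy p c (n + 1) a b = (a + c * b) % p + p * axpy p c n (a / p) (b / p) := rfl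
    rw [h, digitValue_add_mul x hp (Nat.mod_lt _ (by omega)),
      ih _ (Nat.div_lt_of_lt_mul (by rwa [← pow_succ'])), digitValue_eq x hp a,
      digitValue_eq x hp b, cast_mod_of_cast_eq_zero h0, cast_mod_of_cast_eq_zero h0,
      cast_mod_of_cast_eq_zero h0]
    push_cast
    ring

theorem map_digitValue {S : Type*} [CommRing S] (f : R →+* S) (a : ℕ) :
    f (digitValue p x a) = digitValue p (f x) a := by
  unfold digitValue
  induction Nat.digits p a with
  | nil => exact map_zero f
  | cons d l ih =>
    change f (d + x * Nat.ofDigits x l) = d + f x * Nat.ofDigits (f x) l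
    rw [map_add, map_mul, map_natCast, ih]

end DigitValue

open Polynomial in
theorem degree_digitValue_X_lt {R : Type*} [CommRing R] {p : ℕ} (hp : 1 < p) {n a : ℕ}
    (ha : a < p ^ n) : (digitValue p (X : R[X]) a).degree < n := by
  induction n generalizing a with
  | zero =>
    obtain rfl : a = 0 := by simpa using ha
    simp [digitValue_zero]
  | succ n ih =>
    have h := ih (Nat.div_lt_of_lt_mul (by rwa [← pow_succ']) : a / p < p ^ n)
    rw [degree_lt_iff_coeff_zero] at h ⊢
    intro m hm
    obtain ⟨m, rfl⟩ : ∃ k, m = k + 1 := ⟨m - 1, by omega⟩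
    rw [digitValue_eq _ hp, coeff_add, coeff_X_mul, h m (by omega), coeff_natCast_ite,
      if_neg (by omega), Nat.cast_zero, add_zero]

/-! ### Certified tables and the primitive element they describe -/

namespace FieldData

variable {D : FieldData} {T L : ℕ}

/-- The conditions tested by `checkTables`. -/
structure ValidTables (D : FieldData) (T L : ℕ) : Prop where
  deg_pos : 1 ≤ D.deg
  redLen_le : D.redLen ≤ D.deg
  red_lt : D.red < D.p ^ D.redLen
  half_lt : D.half < D.order
  getPow_zero : D.getPow T 0 = 1
  getPow_order : D.getPow T D.order = 1
  addOne_half : D.addOne (D.getPow T D.half) = 0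
  getPow_le : ∀ t < D.order, D.getPow T t ≤ D.order
  getPow_succ : ∀ t < D.order, D.getPow T (t + 1) = D.mulRoot (D.getPow T t)
  zech_le : ∀ t < D.order, t ≠ D.half → D.zech T L t ≤ D.order
  getPow_zech : ∀ t < D.order, t ≠ D.half →
    D.getPow T (D.zech T L t) = D.addOne (D.getPow T t)
  order_le : D.order ≤ 2 ^ D.width

theorem validTables_of_checkTables (h : D.checkTables T L = true) : D.ValidTables T L := by
  simp only [checkTables, Bool.and_eq_true, Nat.ble_eq, Nat.beq_eq, Nat.pow_eq] at h
  obtain ⟨⟨⟨⟨⟨⟨⟨⟨h1, h2⟩, h3⟩, h4⟩, h5⟩, h6⟩, h7⟩, h8⟩, h9⟩ := h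
  have h10 : ∀ t < D.order, D.getPow T t ≤ D.order ∧
      D.getPow T (t + 1) = D.mulRoot (D.getPow T t) ∧ (t ≠ D.half →
        D.zech T L t ≤ D.order ∧ D.getPow T (D.zech T L t) = D.addOne (D.getPow T t)) := by
    intro t ht
    have := forall_of_allBlock h9 t (by omega) (by omega)
    simp only [force_eq, Bool.or_eq_true, Bool.and_eq_true, Nat.ble_eq, Nat.beq_eq] at this
    obtain h | ⟨⟨h, h'⟩, h''⟩ := this
    · omega
    · exact ⟨h, h', fun hne => h''.resolve_left hne⟩
  exact ⟨h1, h2, h3, h4, h5, h6, h8, fun t ht => (h10 t ht).1, fun t ht => (h10 t ht).2.1,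
    fun t ht hh => ((h10 t ht).2.2 hh).1, fun t ht hh => ((h10 t ht).2.2 hh).2, h7⟩

section Value

variable {R : Type*} [CommRing R] {x : R}

/-- Multiplication by `p` shifts the digits; the bound on `a` leaves a single overflow digit `c` at
place `deg`, and `hx` trades `c * x ^ deg` for `c` times the value of `red`. -/
theorem digitValue_mulRoot (hp : 1 < D.p) (h0 : (D.p : R) = 0) (hred : D.red < D.p ^ D.redLen)
    (hx : x ^ D.deg = digitValue D.p x D.red) {a : ℕ} (ha : a < D.p ^ D.deg) :
    digitValue D.p x (D.mulRoot a) = x * digitValue D.p x a := by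
  set c := D.p * a / D.p ^ D.deg with hc
  have hcp : c < D.p := Nat.div_lt_of_lt_mul (by
    rw [mul_comm]; exact Nat.mul_lt_mul_of_pos_right ha (by omega))
  have h : D.mulRoot a = bif Nat.beq c 0 then D.p * a else
      axpy D.p c D.redLen (D.p * a - c * D.p ^ D.deg) D.red := rfl
  rw [h, ← digitValue_base_mul x hp]
  cases hb : Nat.beq c 0
  · rw [cond_false, digitValue_axpy x hp h0 c _ hred, mul_comm c, hc, ← Nat.mod_eq_sub_mul_div,
      digitValue_eq_mod_add_div x hp D.deg (D.p * a), ← hc, digitValue_of_lt x hp hcp, hx,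
      mul_comm (c : R)]
  · rfl

theorem digitValue_addOne (hp : 1 < D.p) (h0 : (D.p : R) = 0) (a : ℕ) :
    digitValue D.p x (D.addOne a) = 1 + digitValue D.p x a := by
  have h : D.addOne a = (a + 1) % D.p + D.p * (a / D.p) := by rw [add_comm]; rfl
  rw [h, digitValue_add_mul x hp (Nat.mod_lt _ (by omega)), digitValue_eq x hp a,
    cast_mod_of_cast_eq_zero h0, cast_mod_of_cast_eq_zero h0]
  push_cast
  ring

/-- The setting is a commutative ring, not a field, because the tables are read in `AdjoinRoot f`
before a root in a field is known. -/
theorem ValidTables.digitValue_getPow (h : D.ValidTables T L) (hp : 1 < D.p) (h0 : (D.p : R) = 0)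
    (hx : x ^ D.deg = digitValue D.p x D.red) {t : ℕ} (ht : t ≤ D.order) :
    digitValue D.p x (D.getPow T t) = x ^ t := by
  induction t with
  | zero => rw [h.getPow_zero, digitValue_of_lt x hp hp]; simp
  | succ t ih =>
    have hlt : D.getPow T t < D.p ^ D.deg := by
      have h1 := h.getPow_le t ht
      have h2 : D.order = D.p ^ D.deg - 1 := rfl
      have h3 : 0 < D.p ^ D.deg := by positivity
      omega
    rw [h.getPow_succ t ht, digitValue_mulRoot hp h0 h.red_lt hx hlt, ih (by omega), pow_succ']

theorem ValidTables.pow_order (h : D.ValidTables T L) (hp : 1 < D.p) (h0 : (D.p : R) = 0)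
    (hx : x ^ D.deg = digitValue D.p x D.red) : x ^ D.order = 1 := by
  rw [← h.digitValue_getPow hp h0 hx le_rfl, h.getPow_order, digitValue_of_lt x hp hp, Nat.cast_one]

theorem ValidTables.one_add_pow_half (h : D.ValidTables T L) (hp : 1 < D.p) (h0 : (D.p : R) = 0)
    (hx : x ^ D.deg = digitValue D.p x D.red) : 1 + x ^ D.half = 0 := by
  rw [← h.digitValue_getPow hp h0 hx h.half_lt.le, ← digitValue_addOne hp h0, h.addOne_half,
    digitValue_zero]

theorem ValidTables.one_add_pow (h : D.ValidTables T L) (hp : 1 < D.p) (h0 : (D.p : R) = 0)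
    (hx : x ^ D.deg = digitValue D.p x D.red) {t : ℕ} (ht : t < D.order) (hth : t ≠ D.half) :
    1 + x ^ t = x ^ D.zech T L t := by
  rw [← h.digitValue_getPow hp h0 hx ht.le, ← digitValue_addOne hp h0, ← h.getPow_zech t ht hth,
    h.digitValue_getPow hp h0 hx (h.zech_le t ht hth)]

end Value

/-- `z` is a primitive element of `E` for which `zech T L` is the Zech logarithm. -/
structure IsZechRoot (D : FieldData) (T L : ℕ) {E : Type*} [Field E] (z : E) : Prop where
  isPrimitiveRoot : IsPrimitiveRoot z D.order
  half_lt : D.half < D.order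
  pow_half : z ^ D.half = -1
  one_add_pow : ∀ t < D.order, t ≠ D.half → 1 + z ^ t = z ^ D.zech T L t

/-- If `z ^ l = 1` with `0 < l < order`, then the exponent `half + l`, reduced modulo the order,
differs from `half`, so the Zech table makes `1 + z ^ (half + l)` a power of `z`, hence nonzero. But
it equals `1 + z ^ half = 0`. -/
theorem ValidTables.isPrimitiveRoot (h : D.ValidTables T L) {E : Type*} [Field E] {z : E}
    (hp : 1 < D.p) (h0 : (D.p : E) = 0) (hz : z ^ D.deg = digitValue D.p z D.red) :
    IsPrimitiveRoot z D.order := by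
  have hord := h.half_lt
  have h1 := h.pow_order hp h0 hz
  have hz0 : z ≠ 0 := by
    rintro rfl
    rw [zero_pow (by omega)] at h1
    exact zero_ne_one h1
  refine IsPrimitiveRoot.mk_of_lt z (by omega) h1 fun l hl0 hl hzl => ?_
  have hmod : (D.half + l) % D.order ≠ D.half := by
    intro he
    rcases lt_or_ge (D.half + l) D.order with hlt | hge
    · rw [Nat.mod_eq_of_lt hlt] at he; omega
    · rw [Nat.mod_eq_sub_mod hge, Nat.mod_eq_of_lt (by omega)] at he; omega
  have h2 := h.one_add_pow hp h0 hz (Nat.mod_lt _ (by omega)) hmod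
  rw [← pow_eq_pow_mod _ h1, pow_add, hzl, mul_one, h.one_add_pow_half hp h0 hz] at h2
  exact pow_ne_zero _ hz0 h2.symm

open Polynomial in
-- No irreducibility test is needed: the tables, read in `AdjoinRoot f`, show that `f` divides `X ^
-- order - 1`, hence `X ^ |E| - X`, which splits over `E`. So `f` has a root in `E`, and the tables
-- make it primitive.
theorem exists_isZechRoot (hcheck : D.checkTables T L = true) (hp : D.p.Prime)
    (E : Type*) [Field E] [Finite E] [CharP E D.p] (hE : Nat.card E = D.p ^ D.deg) :
    ∃ z : E, D.IsZechRoot T L z := by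
  have h := validTables_of_checkTables hcheck
  have h0 : (D.p : E) = 0 := CharP.cast_eq_zero E D.p
  have hp1 := hp.one_lt
  let f : E[X] := X ^ D.deg - digitValue D.p X D.red
  have hdeg : (digitValue D.p (X : E[X]) D.red).degree < (D.deg : WithBot ℕ) :=
    degree_digitValue_X_lt hp1 (h.red_lt.trans_le (Nat.pow_le_pow_right hp.pos h.redLen_le))
  have hf : f.degree ≠ 0 := by
    have : f.degree = D.deg := by
      rw [degree_sub_eq_left_of_degree_lt (by rwa [degree_X_pow]), degree_X_pow]
    rw [this]
    have := h.deg_pos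
    exact_mod_cast (by omega : D.deg ≠ 0)
  have hdvd : f ∣ X ^ D.order - 1 := by
    rw [← AdjoinRoot.mk_eq_zero, map_sub, map_pow, map_one, sub_eq_zero]
    refine h.pow_order hp1 ?_ ?_
    · rw [← map_natCast (AdjoinRoot.of f), h0, map_zero]
    · rw [← map_digitValue, ← map_pow, ← sub_eq_zero, ← map_sub]
      exact AdjoinRoot.mk_self
  have := Fintype.ofFinite E
  have hcard : D.order + 1 = Fintype.card E := by
    rw [Fintype.card_eq_nat_card, hE]
    have : D.order = D.p ^ D.deg - 1 := rfl
    have : 0 < D.p ^ D.deg := by positivity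
    omega
  have hdvd' : f ∣ X ^ Fintype.card E - X :=
    hdvd.trans ⟨X, by rw [← hcard]; ring⟩
  have hsplit : f.Splits := by
    refine Splits.of_dvd ?_ (FiniteField.X_pow_card_sub_X_ne_zero E Fintype.one_lt_card) hdvd'
    simpa using (FiniteField.isSplittingField_sub E E).splits
  obtain ⟨z, hz⟩ := hsplit.exists_eval_eq_zero hf
  have hz' : z ^ D.deg = digitValue D.p z D.red := by
    have : eval z (digitValue D.p X D.red) = digitValue D.p z D.red := by
      have := map_digitValue (p := D.p) X (evalRingHom z) D.red
      simpa using this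
    rw [← this, ← sub_eq_zero, ← hz]
    simp [f]
  exact ⟨z, h.isPrimitiveRoot hp1 h0 hz', h.half_lt,
    eq_neg_of_add_eq_zero_right (h.one_add_pow_half hp1 h0 hz'),
    fun t ht hth => h.one_add_pow hp1 h0 hz' ht hth⟩

end FieldData

/-! ### Collinear triples and the Frobenius map -/

/-- No three points of a line of the projective space of `E` over `F` are mapped to points of a line
by the power map with exponent `m`; up to scaling, the points are `1`, `y` and `1 + y`. -/
def PreservesNoTriple (F E : Type*) [Field F] [Field E] [Algebra F E] (m : ℕ) : Prop :=
  ∀ y : E, y ∉ Set.range (algebraMap F E) → ∀ a b : F, a ≠ 0 → b ≠ 0 →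
    (1 + y) ^ m ≠ algebraMap F E a + algebraMap F E b * y ^ m

section FiniteFields

variable {F E : Type*} [Field F] [Field E] [Algebra F E]

open Polynomial in
-- `X ^ |F| - X` already splits over `F`, so it acquires no new roots in `E`.
theorem mem_range_algebraMap_of_pow_card_eq_self [Finite F] {y : E} (hy : y ^ Nat.card F = y) :
    y ∈ Set.range (algebraMap F E) := by
  have := Fintype.ofFinite F
  rw [Nat.card_eq_fintype_card] at hy
  have hs : (X ^ Fintype.card F - X : F[X]).Splits := by
    simpa using (FiniteField.isSplittingField_sub F F).splits
  refine hs.mem_range_of_isRoot (FiniteField.X_pow_card_sub_X_ne_zero F Fintype.one_lt_card) ?_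
  simp [hy]

/-- `y` witnesses the failure of `PreservesNoTriple`. -/
def IsBadPoint (F : Type*) {E : Type*} [Field F] [Field E] [Algebra F E] (m : ℕ) (y : E) : Prop :=
  y ∉ Set.range (algebraMap F E) ∧ ∃ a b : F, a ≠ 0 ∧ b ≠ 0 ∧
    (1 + y) ^ m = algebraMap F E a + algebraMap F E b * y ^ m

/-- Raising the equation to the power `p` is additive; the scalars become `a ^ p` and `b ^ p`.
Surjectivity of Frobenius on `F` keeps `y ^ p` outside `F`. -/
theorem IsBadPoint.pow_char [Finite F] {p : ℕ} [Fact p.Prime] [CharP F p] [CharP E p] {m : ℕ}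
    {y : E} (h : IsBadPoint F m y) : IsBadPoint F m (y ^ p) := by
  obtain ⟨hy, a, b, ha, hb, hab⟩ := h
  refine ⟨?_, a ^ p, b ^ p, pow_ne_zero _ ha, pow_ne_zero _ hb, ?_⟩
  · rintro ⟨c, hc⟩
    obtain ⟨d, rfl⟩ := (Finite.injective_iff_surjective.1 (frobenius_inj F p)) c
    refine hy ⟨d, frobenius_inj E p ?_⟩
    exact ((algebraMap F E).map_frobenius p d).symm.trans hc
  · calc (1 + y ^ p) ^ m = ((1 + y) ^ m) ^ p := by
          rw [← one_pow (M := E) p, ← add_pow_char, one_pow, pow_right_comm]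
      _ = _ := by rw [hab, add_pow_char, mul_pow, map_pow, map_pow, pow_right_comm y m p]

theorem IsBadPoint.pow_char_pow [Finite F] {p : ℕ} [Fact p.Prime] [CharP F p] [CharP E p] {m : ℕ}
    {y : E} (h : IsBadPoint F m y) (j : ℕ) : IsBadPoint F m (y ^ p ^ j) := by
  induction j with
  | zero => simpa using h
  | succ j ih => simpa only [pow_succ, pow_mul] using ih.pow_char (p := p)

end FiniteFields

/-! ### From the numerical test to `PreservesNoTriple` -/

namespace FieldData

variable {D : FieldData} {T L N r w : ℕ}

theorem checkTriple_of_checkPowers {t u n m k : ℕ}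
    (h : D.checkPowers T L N r w t u n m = true) (hk : 1 ≤ k) (hkn : k ≤ n) :
    D.checkTriple T L N r (m * w ^ k % D.order) t u = true := by
  induction n generalizing m k with
  | zero => omega
  | succ n ih =>
    have h' : (D.checkTriple T L N r (m * w % D.order) t u &&
      D.checkPowers T L N r w t u n (m * w % D.order)) = true := h
    rw [Bool.and_eq_true] at h'
    rcases Nat.eq_or_lt_of_le hk with rfl | hk
    · simpa using h'.1
    · have := ih h'.2 (k := k - 1) (by omega) (by omega)
      rwa [Nat.mod_mul_mod, mul_assoc, ← pow_succ', Nat.sub_add_cancel (by omega)] at this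

variable {F E : Type*} [Field F] [Field E] [Algebra F E]

theorem IsZechRoot.not_isBadPoint_of_checkTriple [Finite F] {z : E} (hz : D.IsZechRoot T L z)
    (hF : Nat.card F = r + 1) (hN : N * r = D.order) {m t : ℕ} (ht : t < D.order)
    (htN : t % N ≠ 0)
    (h : D.checkTriple T L N r (m % D.order) t (D.zech T L t) = true) :
    ¬ IsBadPoint F m (z ^ t) := by
  rintro ⟨hy, a, b, ha, hb, hab⟩
  have hord : 0 < D.order := by omega
  have hr : r ≠ 0 := by rintro rfl; omega
  have : NeZero r := ⟨hr⟩
  have hprim := hz.isPrimitiveRoot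
  have hz0 : z ≠ 0 := hprim.ne_zero hord.ne'
  have hzN : IsPrimitiveRoot (z ^ N) r := hprim.pow hord hN.symm
  have hpow : ∀ c : F, c ≠ 0 → ∃ i < r, (z ^ N) ^ i = algebraMap F E c := by
    intro c hc
    have := Fintype.ofFinite F
    refine hzN.eq_pow_of_pow_eq_one ?_
    have h1 : Fintype.card F - 1 = r := by rw [Fintype.card_eq_nat_card, hF]; rfl
    rw [← map_pow, ← h1, FiniteField.pow_card_sub_one_eq_one c hc, map_one]
  obtain ⟨e, -, he⟩ := hpow a ha
  obtain ⟨c, hc, hcb⟩ := hpow (b / a) (div_ne_zero hb ha)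
  have hred : ∀ n, z ^ (m % D.order * n) = z ^ (m * n) := fun n => by
    rw [pow_mul, ← pow_eq_pow_mod m hprim.pow_eq_one, ← pow_mul]
  have hth : t ≠ D.half := by
    rintro rfl
    exact hy ⟨-1, by rw [hz.pow_half, map_neg, map_one]⟩
  set i := (m % D.order * t + c * N) % D.order with hi
  have hzi : z ^ i = algebraMap F E (b / a) * z ^ (t * m) := by
    rw [hi, ← pow_eq_pow_mod _ hprim.pow_eq_one, pow_add, hred, ← hcb, ← pow_mul, mul_comm N c,
      mul_comm t m, mul_comm]
  -- Factoring out `a` leaves `1 + (b / a) * y ^ m`, and `b / a` is absorbed into the exponent `i`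
  -- as a multiple of `N`.
  have hab' : z ^ (m * D.zech T L t) = algebraMap F E a * (1 + z ^ i) := by
    have ha' : algebraMap F E a ≠ 0 := by simpa using ha
    rw [hzi, mul_comm m, pow_mul, ← hz.one_add_pow t ht hth, hab, ← pow_mul, map_div₀]
    field_simp
  have hcheck := allBelow_eq_true_iff.1 h c hc
  change (Nat.beq i D.half || !Nat.beq (D.zech T L i % N) (m % D.order * D.zech T L t % N)) = true
    at hcheck
  rw [Bool.or_eq_true, Nat.beq_eq, Bool.not_eq_true', ← Bool.not_eq_true, Nat.beq_eq] at hcheck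
  rcases hcheck with hhalf | hne
  · rw [hhalf, hz.pow_half, add_neg_cancel, mul_zero] at hab'
    exact pow_ne_zero _ hz0 hab'
  · by_cases hhalf : i = D.half
    · rw [hhalf, hz.pow_half, add_neg_cancel, mul_zero] at hab'
      exact pow_ne_zero _ hz0 hab'
    rw [hz.one_add_pow i (Nat.mod_lt _ hord) hhalf, ← he, ← pow_mul, ← pow_add, ← hred] at hab'
    rw [pow_eq_pow_mod _ hprim.pow_eq_one, pow_eq_pow_mod (N * e + _) hprim.pow_eq_one] at hab'
    replace hab' := hprim.pow_inj (Nat.mod_lt _ hord) (Nat.mod_lt _ hord) hab'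
    -- Modulo `N` the exponent `N * e` of the scalar `a` disappears.
    have hmod := Nat.ModEq.of_dvd (Dvd.intro _ hN) (hab' : Nat.ModEq D.order _ _)
    apply hne
    have h2 : (N * e + D.zech T L i) % N = D.zech T L i % N := Nat.mul_add_mod _ _ _
    rw [← h2]
    exact hmod.symm

theorem IsZechRoot.preservesNoTriple [Finite F] [Finite E] {z : E} (hz : D.IsZechRoot T L z)
    (hp : D.p.Prime) [CharP F D.p] [CharP E D.p] (hE : Nat.card E = D.order + 1)
    (hF : Nat.card F = r + 1) (hN : N * r = D.order) {n : ℕ}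
    (hwidth : D.order ≤ 2 ^ D.width)
    (h : D.checkExponent T L N r w n = true) {k : ℕ} (hk : 1 ≤ k) (hkn : k ≤ n) :
    PreservesNoTriple F E (w ^ k) := by
  classical
  have : Fact D.p.Prime := ⟨hp⟩
  intro y hy a b ha hb hab
  have hord : 0 < D.order := by have := hz.half_lt; omega
  have : NeZero D.order := ⟨hord.ne'⟩
  have hprim := hz.isPrimitiveRoot
  have hex : ∃ t, IsBadPoint F (w ^ k) (z ^ t) := by
    have hy0 : y ≠ 0 := by rintro rfl; exact hy ⟨0, map_zero _⟩
    have := Fintype.ofFinite E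
    have hy1 : y ^ D.order = 1 := by
      have h1 : Fintype.card E - 1 = D.order := by rw [Fintype.card_eq_nat_card, hE]; rfl
      rw [← h1, FiniteField.pow_card_sub_one_eq_one y hy0]
    obtain ⟨t, -, rfl⟩ := hprim.eq_pow_of_pow_eq_one hy1
    exact ⟨t, hy, a, b, ha, hb, hab⟩
  -- The least bad exponent is in particular least in its Frobenius orbit, so `checkExponent` does
  -- not skip it.
  have hbad := Nat.find_spec hex
  have hmin := fun s hs => Nat.find_min' hex (m := s) hs
  set t := Nat.find hex
  have ht : t < D.order := by
    have := hmin (t % D.order) (by rwa [← pow_eq_pow_mod t hprim.pow_eq_one])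
    exact this.trans_lt (Nat.mod_lt _ hord)
  have htN : t % N ≠ 0 := by
    intro h0
    obtain ⟨s, hs⟩ := Nat.dvd_of_mod_eq_zero h0
    refine hbad.1 (mem_range_algebraMap_of_pow_card_eq_self ?_)
    rw [hF, pow_succ, ← pow_mul, hs, mul_right_comm, hN, pow_mul, hprim.pow_eq_one, one_pow,
      one_mul]
  have hcheck := forall_of_allBlock h t (by omega) (by omega)
  simp only [force_eq, Bool.or_eq_true, Nat.ble_eq, Nat.beq_eq, Bool.not_eq_true'] at hcheck
  rcases hcheck with ((h1 | h1) | h1) | h1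
  · omega
  · exact htN h1
  · rw [← Bool.not_eq_true, allBelow_eq_true_iff] at h1
    refine h1 fun j _ => Nat.ble_eq ▸ hmin _ ?_
    change IsBadPoint F (w ^ k) (z ^ (D.p ^ j * t % D.order))
    rw [← pow_eq_pow_mod _ hprim.pow_eq_one, mul_comm, pow_mul]
    exact hbad.pow_char_pow j
  · have h2 := checkTriple_of_checkPowers h1 hk hkn
    rw [one_mul] at h2
    exact hz.not_isBadPoint_of_checkTriple hF hN ht htN h2 hbad

end FieldData

/-! ### Power maps on labels and on points -/

section Powers

variable {F E : Type*} [Field F] [Field E] [Algebra F E]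

theorem eq_of_pow_eq_pow_of_coprime [Finite E] {m : ℕ} (hm : m.Coprime (Nat.card E - 1)) {x y : E}
    (hx : x ≠ 0) (hy : y ≠ 0) (h : x ^ m = y ^ m) : x = y := by
  have hm' : (Nat.card Eˣ).Coprime m := by rw [Nat.card_units]; exact hm.symm
  have := (powCoprime hm').injective (a₁ := Units.mk0 x hx) (a₂ := Units.mk0 y hy)
    (Units.ext (by simpa using h))
  simpa using congrArg Units.val this

theorem exists_pow_eq_of_coprime [Finite F] {m : ℕ} (hm : m.Coprime (Nat.card F - 1)) {c : F}
    (hc : c ≠ 0) : ∃ b : F, b ≠ 0 ∧ b ^ m = c := by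
  have hm' : (Nat.card Fˣ).Coprime m := by rw [Nat.card_units]; exact hm.symm
  obtain ⟨b, hb⟩ := (powCoprime hm').surjective (Units.mk0 c hc)
  exact ⟨b, b.ne_zero, by simpa using congrArg Units.val hb⟩

theorem card_sub_one_dvd [Finite F] [Finite E] : Nat.card F - 1 ∣ Nat.card E - 1 := by
  rw [Module.natCard_eq_pow_finrank (K := F) (V := E)]
  exact Nat.sub_one_dvd_pow_sub_one _ _

/-- Power maps with exponent coprime to the order of the multiplicative group are injective on
points. -/
theorem exists_eq_mul_of_pow_eq_mul_pow [Finite F] [Finite E] {m : ℕ}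
    (hm : m.Coprime (Nat.card E - 1)) {x y : E} (hx : x ≠ 0) (hy : y ≠ 0) {c : F} (hc : c ≠ 0)
    (h : x ^ m = algebraMap F E c * y ^ m) : ∃ b : F, b ≠ 0 ∧ x = algebraMap F E b * y := by
  obtain ⟨b, hb, rfl⟩ := exists_pow_eq_of_coprime
    (hm.coprime_dvd_right (card_sub_one_dvd (F := F) (E := E))) hc
  refine ⟨b, hb, eq_of_pow_eq_pow_of_coprime hm hx (mul_ne_zero (by simpa using hb) hy) ?_⟩
  rw [h, mul_pow, map_pow]

end Powers

section Label

variable {F E : Type*} [Field F] [Field E] [Algebra F E]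

/-- A primitive element generates `E`, so its minimal polynomial has degree `d + 1` and `1, …, z ^
d` are independent; multiplication by `z` gives the shifted exponents of `label`. -/
theorem linearIndependent_pow_succ [Finite E] {d : ℕ} {z : E}
    (hz : IsPrimitiveRoot z (Nat.card E - 1)) (hd : Module.finrank F E = d + 1) :
    LinearIndependent F fun i : Fin (d + 1) => z ^ ((i : ℕ) + 1) := by
  have := Fintype.ofFinite E
  have hcard : Fintype.card E - 1 = Nat.card E - 1 := by rw [Fintype.card_eq_nat_card]
  have hpos : 0 < Nat.card E - 1 := by have := Finite.one_lt_card (α := E); omega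
  have : NeZero (Nat.card E - 1) := ⟨hpos.ne'⟩
  have : FiniteDimensional F E := Module.finite_of_finrank_pos (by omega)
  have hz0 : z ≠ 0 := hz.ne_zero hpos.ne'
  have htop : IntermediateField.adjoin F {z} = ⊤ := by
    rw [eq_top_iff]
    intro y _
    by_cases hy : y = 0
    · rw [hy]; exact zero_mem _
    · obtain ⟨i, -, rfl⟩ := hz.eq_pow_of_pow_eq_one
        (by rw [← hcard, FiniteField.pow_card_sub_one_eq_one y hy])
      exact pow_mem (IntermediateField.mem_adjoin_simple_self F z) i
  have hdeg : (minpoly F z).natDegree = d + 1 := by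
    rw [← IntermediateField.adjoin.finrank (Algebra.IsIntegral.isIntegral z), htop,
      IntermediateField.finrank_top', hd]
  have h := linearIndependent_pow (K := F) z
  rw [hdeg] at h
  have h' := h.map' (LinearMap.mulLeft F z)
    (LinearMap.ker_eq_bot.2 (mul_right_injective₀ hz0))
  have heq : (fun i : Fin (d + 1) => z ^ ((i : ℕ) + 1)) =
      LinearMap.mulLeft F z ∘ fun i : Fin (d + 1) => z ^ (i : ℕ) := by
    funext i
    simp [pow_succ']
  rw [heq]
  exact h'

/-- The labelling of coordinate vectors, as a linear equivalence. -/
theorem exists_labelEquiv [Finite E] {d : ℕ} {z : E}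
    (hz : IsPrimitiveRoot z (Nat.card E - 1)) (hd : Module.finrank F E = d + 1) :
    ∃ e : (Fin (d + 1) → F) ≃ₗ[F] E, ∀ x, e x = label z x := by
  let b := basisOfLinearIndependentOfCardEqFinrank (linearIndependent_pow_succ hz hd)
    (by rw [Fintype.card_fin, hd])
  refine ⟨b.equivFun.symm, fun x => ?_⟩
  rw [Module.Basis.equivFun_symm_apply, label]
  simp [b]

theorem exists_isPowerMap [Finite F] [Finite E] {d m : ℕ} {z : E}
    (hz : IsPrimitiveRoot z (Nat.card E - 1)) (hd : Module.finrank F E = d + 1)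
    (hm : m.Coprime (Nat.card E - 1)) :
    ∃ f : PGPoint d F ≃ PGPoint d F, IsPowerMap z m f := by
  obtain ⟨e, he⟩ := exists_labelEquiv (F := F) hz hd
  have hne : ∀ v : {v : Fin (d + 1) → F // v ≠ 0}, e.symm (e v ^ m) ≠ 0 := fun v => by
    simpa using fun h => (v.2 h).elim
  let g : PGPoint d F → PGPoint d F := Projectivization.lift
    (fun v => Projectivization.mk F (e.symm (e v ^ m)) (hne v)) (by
      intro a b t hab
      rw [Projectivization.mk_eq_mk_iff']
      refine ⟨t ^ m, ?_⟩
      rw [hab, map_smul e t, smul_pow, map_smul])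
  have hg : ∀ v (hv : v ≠ 0), g (Projectivization.mk F v hv) =
      Projectivization.mk F (e.symm (e v ^ m)) (hne ⟨v, hv⟩) := fun v hv =>
    Projectivization.lift_mk _ _ v hv
  have hinj : Function.Injective g := by
    intro P Q
    induction P using Projectivization.ind with | h v hv => ?_
    induction Q using Projectivization.ind with | h u hu => ?_
    intro h
    rw [hg, hg, Projectivization.mk_eq_mk_iff'] at h
    obtain ⟨c, hc⟩ := h
    rw [← map_smul, e.symm.injective.eq_iff, Algebra.smul_def] at hc
    have hv' : e v ≠ 0 := by simpa using hv
    have hu' : e u ≠ 0 := by simpa using hu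
    have hc0 : c ≠ 0 := by
      rintro rfl
      rw [map_zero, zero_mul] at hc
      exact pow_ne_zero _ hv' hc.symm
    obtain ⟨b, -, hb⟩ := exists_eq_mul_of_pow_eq_mul_pow hm hv' hu' hc0 hc.symm
    rw [Projectivization.mk_eq_mk_iff']
    exact ⟨b, e.injective (by rw [map_smul, Algebra.smul_def, hb])⟩
  refine ⟨Equiv.ofBijective g ⟨hinj, Finite.surjective_of_injective hinj⟩, ?_⟩
  intro x y hx hy hxy
  rw [← he, ← he] at hxy
  refine (hg x hx).trans ?_
  congr 1
  rw [← hxy, e.symm_apply_apply]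

end Label

/-! ### Collinearity and orthogoval pairs -/

section Lines

variable {F V : Type*} [Field F] [AddCommGroup V] [Module F V]

theorem exists_eq_smul_add_smul {W : Submodule F V} (hW : Module.finrank F W = 2) {v₁ v₂ v₃ : V}
    (h₁ : v₁ ≠ 0) (h₂ : v₂ ≠ 0) (h₃ : v₃ ≠ 0) (hv₁ : v₁ ∈ W) (hv₂ : v₂ ∈ W) (hv₃ : v₃ ∈ W)
    (h₁₂ : Projectivization.mk F v₁ h₁ ≠ Projectivization.mk F v₂ h₂)
    (h₁₃ : Projectivization.mk F v₁ h₁ ≠ Projectivization.mk F v₃ h₃)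
    (h₂₃ : Projectivization.mk F v₂ h₂ ≠ Projectivization.mk F v₃ h₃) :
    ∃ a b : F, a ≠ 0 ∧ b ≠ 0 ∧ v₃ = a • v₁ + b • v₂ := by
  have hW' : FiniteDimensional F W := Module.finite_of_finrank_pos (by omega)
  rw [Ne, eq_comm, Projectivization.mk_eq_mk_iff', not_exists] at h₁₂ h₁₃ h₂₃
  have hli : LinearIndependent F ![v₁, v₂] := (LinearIndependent.pair_iff' h₁).2 h₁₂
  have hspan : Submodule.span F {v₁, v₂} = W := by
    refine Submodule.eq_of_le_of_finrank_eq ?_ ?_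
    · rw [Submodule.span_le]
      rintro x (rfl | rfl)
      exacts [hv₁, hv₂]
    · have := finrank_span_eq_card hli
      rw [Matrix.range_cons_cons_empty, Fintype.card_fin] at this
      rw [this, hW]
  rw [← hspan, Submodule.mem_span_pair] at hv₃
  obtain ⟨a, b, hab⟩ := hv₃
  refine ⟨a, b, ?_, ?_, hab.symm⟩
  · rintro rfl
    exact h₂₃ b (by rw [← hab, zero_smul, zero_add])
  · rintro rfl
    exact h₁₃ a (by rw [← hab, zero_smul, add_zero])

end Lines

section Spaces

variable {d : ℕ} {F : Type*} [Field F]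

theorem AreOrthogoval.symm {P : Type*} {L M : Set (Set P)} (h : AreOrthogoval L M) :
    AreOrthogoval M L := fun l hl m hm => by
  rw [Set.inter_comm]
  exact h m hm l hl

theorem exists_standardLines_two_lt_encard (hd : 0 < d) :
    ∃ l ∈ standardLines d F, 2 < l.encard := by
  let u : Fin (d + 1) → F := Pi.single 0 1
  let v : Fin (d + 1) → F := Pi.single (Fin.last d) 1
  have h0 : (0 : Fin (d + 1)) ≠ Fin.last d := by
    rw [Ne, Fin.ext_iff]; simpa using hd.ne
  have hu0 : u 0 = 1 := Pi.single_eq_same _ _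
  have huv : u (Fin.last d) = 0 := Pi.single_eq_of_ne h0.symm _
  have hv0 : v 0 = 0 := Pi.single_eq_of_ne h0 _
  have hvv : v (Fin.last d) = 1 := Pi.single_eq_same _ _
  have hu : u ≠ 0 := fun h => by simpa [hu0] using congrFun h 0
  have hv : v ≠ 0 := fun h => by simpa [hvv] using congrFun h (Fin.last d)
  have huv' : u + v ≠ 0 := fun h => by simpa [hu0, hv0] using congrFun h 0
  have hli : LinearIndependent F ![u, v] := (LinearIndependent.pair_iff' hu).2 fun a h => by
    simpa [huv, hvv] using congrFun h (Fin.last d)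
  have hW : Module.finrank F (Submodule.span F {u, v}) = 2 := by
    have := finrank_span_eq_card hli
    rwa [Matrix.range_cons_cons_empty, Fintype.card_fin] at this
  have hmem : ∀ x (hx : x ≠ 0), x ∈ Submodule.span F {u, v} →
      Projectivization.mk F x hx ∈
        {x : PGPoint d F | x.submodule ≤ Submodule.span F {u, v}} := by
    intro x hx h
    rw [Set.mem_ofPred_eq, Projectivization.submodule_mk, Submodule.span_singleton_le_iff_mem]
    exact h
  have hu' : u ∈ Submodule.span F {u, v} := Submodule.subset_span (by simp)
  have hv' : v ∈ Submodule.span F {u, v} := Submodule.subset_span (by simp)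
  refine ⟨_, ⟨_, hW, rfl⟩, ?_⟩
  have h3 : ({Projectivization.mk F u hu, Projectivization.mk F v hv,
      Projectivization.mk F (u + v) huv'} : Set (PGPoint d F)).encard = 3 := by
    rw [Set.encard_eq_three]
    refine ⟨_, _, _, ?_, ?_, ?_, rfl⟩ <;>
      rw [Ne, Projectivization.mk_eq_mk_iff'] <;> rintro ⟨a, ha⟩
    · simpa [hu0, hv0] using congrFun ha 0
    · have h1 := congrFun ha 0
      have h2 := congrFun ha (Fin.last d)
      simp [hu0, huv, hv0, hvv] at h1 h2
      simp [h1] at h2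
    · have h1 := congrFun ha 0
      have h2 := congrFun ha (Fin.last d)
      simp [hu0, huv, hv0, hvv] at h1 h2
      simp [h1] at h2
  refine lt_of_lt_of_le (b := (3 : ℕ∞)) (by norm_num) (h3 ▸ Set.encard_le_encard ?_)
  rintro x (rfl | rfl | rfl)
  exacts [hmem _ _ hu', hmem _ _ hv', hmem _ _ (add_mem hu' hv')]

/-- This yields distinctness of the members of the family, hence its exact cardinality. -/
theorem not_areOrthogoval_self (hd : 0 < d) {P : Type*} (f : PGPoint d F ≃ P) :
    ¬ AreOrthogoval (inducedLines f) (inducedLines f) := by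
  obtain ⟨l, hl, hcard⟩ := exists_standardLines_two_lt_encard (F := F) hd
  intro h
  have := h _ ⟨l, hl, rfl⟩ _ ⟨l, hl, rfl⟩
  rw [Set.inter_self, f.injective.encard_image] at this
  exact absurd hcard this.not_gt

variable {E : Type*} [Field E] [Algebra F E]

/-- Dividing by `a • q₁` brings the triple to the form `1, y, 1 + y` with `y = b q₂ / (a q₁)`; then
`hp` expresses `(1 + y) ^ m` through `1` and `y ^ m` with nonzero scalars. -/
theorem PreservesNoTriple.false_of_collinear {m : ℕ} (h : PreservesNoTriple F E m)
    {p₁ p₂ p₃ q₁ q₂ q₃ : E} {a b a' b' c₁ c₂ c₃ : F} (hq₁ : q₁ ≠ 0)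
    (hq : ∀ c : F, c • q₁ ≠ q₂) (ha : a ≠ 0) (hb : b ≠ 0) (ha' : a' ≠ 0) (hb' : b' ≠ 0)
    (hc₁ : c₁ ≠ 0) (hc₂ : c₂ ≠ 0) (hc₃ : c₃ ≠ 0)
    (hp₁ : p₁ = algebraMap F E c₁ * q₁ ^ m) (hp₂ : p₂ = algebraMap F E c₂ * q₂ ^ m)
    (hp₃ : p₃ = algebraMap F E c₃ * q₃ ^ m)
    (hq₃ : q₃ = a • q₁ + b • q₂) (hp : p₃ = a' • p₁ + b' • p₂) : False := by
  rw [Algebra.smul_def, Algebra.smul_def] at hq₃ hp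
  have hmap : ∀ {c : F}, c ≠ 0 → algebraMap F E c ≠ 0 := fun hc => by simpa using hc
  have hA := hmap ha
  have hB := hmap hb
  have hC := hmap hc₃
  have hq₁m := pow_ne_zero m hq₁
  refine h (algebraMap F E b * q₂ / (algebraMap F E a * q₁)) ?_ (a' * c₁ / (c₃ * a ^ m))
    (b' * c₂ / (c₃ * b ^ m)) (by positivity) (by positivity) ?_
  · rintro ⟨c, hc⟩
    refine hq (c * a / b) ?_
    rw [Algebra.smul_def, map_div₀, map_mul, hc]
    field_simp
  · have h1 : 1 + algebraMap F E b * q₂ / (algebraMap F E a * q₁) =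
        q₃ / (algebraMap F E a * q₁) := by
      rw [hq₃]; field_simp
    have h2 : q₃ ^ m = p₃ / algebraMap F E c₃ := by rw [hp₃]; field_simp
    rw [h1, div_pow, h2, hp, hp₁, hp₂]
    simp only [map_div₀, map_mul, map_pow, div_pow, mul_pow]
    field_simp

theorem areOrthogoval_of_preservesNoTriple [Finite F] [Finite E] {z : E}
    (hz : IsPrimitiveRoot z (Nat.card E - 1)) (hd : Module.finrank F E = d + 1) {m n : ℕ}
    (hm : m.Coprime (Nat.card E - 1)) (hn : PreservesNoTriple F E n)
    {f g : PGPoint d F ≃ PGPoint d F} (hf : IsPowerMap z m f) (hg : IsPowerMap z (m * n) g) :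
    AreOrthogoval (inducedLines f) (inducedLines g) := by
  obtain ⟨e, he⟩ := exists_labelEquiv (F := F) hz hd
  have hmk : ∀ {k : ℕ} {f : PGPoint d F ≃ PGPoint d F}, IsPowerMap z k f → ∀ v (hv : v ≠ 0),
      ∃ h, f (Projectivization.mk F v hv) = Projectivization.mk F (e.symm (e v ^ k)) h := by
    intro k f hf v hv
    have h : e.symm (e v ^ k) ≠ 0 := by simpa using fun h => (hv h).elim
    exact ⟨h, hf v _ hv h (by rw [← he, ← he, e.apply_symm_apply])⟩
  -- A common point gives `v ^ m ~ u ^ (m * n)` up to scalars on labels, and injectivity of the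
  -- power map with exponent `m` cancels `m`.
  have key : ∀ v (hv : v ≠ 0) u (hu : u ≠ 0),
      f (Projectivization.mk F v hv) = g (Projectivization.mk F u hu) →
      ∃ c : F, c ≠ 0 ∧ e v = algebraMap F E c * e u ^ n := by
    intro v hv u hu h
    obtain ⟨_, h1⟩ := hmk hf v hv
    obtain ⟨_, h2⟩ := hmk hg u hu
    rw [h1, h2, Projectivization.mk_eq_mk_iff'] at h
    obtain ⟨c, hc⟩ := h
    rw [← map_smul, e.symm.injective.eq_iff, Algebra.smul_def, mul_comm m, pow_mul] at hc
    have hv' : e v ≠ 0 := by simpa using hv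
    have hu' : e u ≠ 0 := by simpa using hu
    refine exists_eq_mul_of_pow_eq_mul_pow hm hv' (pow_ne_zero n hu') (c := c) ?_ hc.symm
    rintro rfl
    rw [map_zero, zero_mul] at hc
    exact pow_ne_zero _ hv' hc.symm
  rintro _ ⟨_, ⟨W, hW, rfl⟩, rfl⟩ _ ⟨_, ⟨U, hU, rfl⟩, rfl⟩
  by_contra hlt
  obtain ⟨t, hts, ht⟩ := Set.exists_subset_encard_eq (Order.add_one_le_of_lt (not_le.1 hlt))
  obtain ⟨X₁, X₂, X₃, h₁₂, h₁₃, h₂₃, rfl⟩ := Set.encard_eq_three.1 (ht.trans (by norm_num))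
  have hX : ∀ X ∈ ({X₁, X₂, X₃} : Set (PGPoint d F)), ∃ v, ∃ hv : v ≠ 0, ∃ u, ∃ hu : u ≠ 0,
      v ∈ W ∧ u ∈ U ∧ f (Projectivization.mk F v hv) = X ∧ g (Projectivization.mk F u hu) = X := by
    intro X hX
    obtain ⟨⟨P, hP, hPX⟩, ⟨Q, hQ, hQX⟩⟩ := hts hX
    induction P using Projectivization.ind with | h v hv => ?_
    induction Q using Projectivization.ind with | h u hu => ?_
    rw [Set.mem_ofPred_eq, Projectivization.submodule_mk,
      Submodule.span_singleton_le_iff_mem] at hP hQ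
    exact ⟨v, hv, u, hu, hP, hQ, hPX, hQX⟩
  obtain ⟨v₁, hv₁, u₁, hu₁, hvW₁, huU₁, rfl, hg₁⟩ := hX X₁ (by simp)
  obtain ⟨v₂, hv₂, u₂, hu₂, hvW₂, huU₂, rfl, hg₂⟩ := hX X₂ (by simp)
  obtain ⟨v₃, hv₃, u₃, hu₃, hvW₃, huU₃, rfl, hg₃⟩ := hX X₃ (by simp)
  obtain ⟨c₁, hc₁, hp₁⟩ := key _ _ _ _ hg₁.symm
  obtain ⟨c₂, hc₂, hp₂⟩ := key _ _ _ _ hg₂.symm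
  obtain ⟨c₃, hc₃, hp₃⟩ := key _ _ _ _ hg₃.symm
  obtain ⟨a', b', ha', hb', hv⟩ := exists_eq_smul_add_smul hW hv₁ hv₂ hv₃ hvW₁ hvW₂ hvW₃
    (fun h => h₁₂ (congrArg f h)) (fun h => h₁₃ (congrArg f h)) (fun h => h₂₃ (congrArg f h))
  rw [← hg₁, ← hg₂] at h₁₂
  rw [← hg₁, ← hg₃] at h₁₃
  rw [← hg₂, ← hg₃] at h₂₃
  obtain ⟨a, b, ha, hb, hu⟩ := exists_eq_smul_add_smul hU hu₁ hu₂ hu₃ huU₁ huU₂ huU₃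
    (fun h => h₁₂ (congrArg g h)) (fun h => h₁₃ (congrArg g h)) (fun h => h₂₃ (congrArg g h))
  refine hn.false_of_collinear (q₁ := e u₁) (q₂ := e u₂) (by simpa using hu₁) (fun c hc => ?_)
    ha hb ha' hb' hc₁ hc₂ hc₃ hp₁ hp₂ hp₃ (by rw [hu, map_add, map_smul, map_smul])
    (by rw [hv, map_add, map_smul, map_smul])
  rw [← map_smul, e.injective.eq_iff] at hc
  exact h₁₂ (congrArg g ((Projectivization.mk_eq_mk_iff' _ _ _ _ _).2 ⟨c, hc⟩).symm)

end Spaces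

/-! ### Assembly of the families and the seven computations -/

theorem hasMutuallyOrthogovalPG_of_preservesNoTriple.{u} {d N w : ℕ} (hd : 0 < d) {F E : Type u}
    [Field F] [Finite F] [Field E] [Finite E] [Algebra F E] (hE : Module.finrank F E = d + 1)
    {z : E} (hz : IsPrimitiveRoot z (Nat.card E - 1)) (hw : w.Coprime (Nat.card F ^ (d + 1) - 1))
    (h : ∀ k, 1 ≤ k → k < N → PreservesNoTriple F E (w ^ k)) :
    HasMutuallyOrthogovalPG d F N := by
  have hcard : Nat.card E = Nat.card F ^ (d + 1) := by
    rw [← hE]; exact Module.natCard_eq_pow_finrank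
  have hw' : ∀ i, (w ^ i).Coprime (Nat.card E - 1) := fun i => by
    rw [hcard]; exact hw.pow_left i
  choose f hf using fun i : Fin N => exists_isPowerMap (F := F) hz hE (hw' i)
  have hlt : ∀ i j : Fin N, i < j →
      AreOrthogoval (inducedLines (f i)) (inducedLines (f j)) := by
    intro i j hij
    have hij' : (i : ℕ) < j := hij
    -- Relative to the space with exponent `w ^ i`, the one with exponent `w ^ j` is given by `w ^
    -- (j - i)`.
    refine areOrthogoval_of_preservesNoTriple (n := w ^ (j - i : ℕ)) hz hE (hw' i)
      (h _ (by omega) (by omega)) (hf i) ?_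
    rw [← pow_add, Nat.add_sub_cancel' hij'.le]
    exact hf j
  have hne : ∀ i j : Fin N, i ≠ j →
      AreOrthogoval (inducedLines (f i)) (inducedLines (f j)) := fun i j hij =>
    (lt_or_gt_of_ne hij).elim (hlt i j) fun h => (hlt j i h).symm
  have hinj : Function.Injective fun i => inducedLines (f i) := by
    intro i j hij
    by_contra hcon
    refine not_areOrthogoval_self hd (f i) ?_
    have h1 := hne i j hcon
    rwa [← show inducedLines (f i) = inducedLines (f j) from hij] at h1
  refine ⟨Set.range fun i => inducedLines (f i), ⟨Set.finite_range _, ?_, ?_, ?_⟩, w, hw, E, _, _,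
    z, hE, hz, f, hf, rfl⟩
  · rw [Set.ncard_range_of_injective hinj, Nat.card_fin]
  · rintro _ ⟨i, rfl⟩
    exact ⟨f i, rfl⟩
  · rintro _ ⟨i, rfl⟩ _ ⟨j, rfl⟩ hij
    exact hne i j fun h => hij (by rw [h])

/-- Over the field with `r + 1` elements, a successful `check` gives `n + 1` mutually orthogoval
spaces. -/
theorem FieldData.hasMutuallyOrthogovalPG.{u} (D : FieldData) (N r w n : ℕ)
    (hcheck : D.check N r w n = true) (hp : D.p.Prime) (hN : N * r = D.order)
    (hw : w.Coprime D.order) {F : Type u} [Field F] (hF : Nat.card F = r + 1) {k d : ℕ}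
    (hr : r + 1 = D.p ^ k) (hd : 0 < d) (hdeg : k * (d + 1) = D.deg) :
    HasMutuallyOrthogovalPG d F (n + 1) := by
  have : Fact D.p.Prime := ⟨hp⟩
  have : Finite F := Nat.finite_of_card_ne_zero (by omega)
  have : CharP F D.p := by
    have := Fintype.ofFinite F
    exact charP_of_card_eq_prime_pow (f := k) (by rw [Fintype.card_eq_nat_card, hF, hr])
  -- `IsPowerMapFamily` asks for `E` in the universe of `F`.
  let E := ULift.{u} (FiniteField.Extension F D.p (d + 1))
  have hE : Module.finrank F E = d + 1 := by
    rw [(ULift.algEquiv (R := F)).toLinearEquiv.finrank_eq]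
    exact FiniteField.finrank_extension F D.p (d + 1)
  have : CharP E D.p := charP_of_injective_algebraMap (algebraMap F E).injective D.p
  have : FiniteDimensional F E := Module.finite_of_finrank_pos (by omega)
  have hcardF : Nat.card F ^ (d + 1) = D.p ^ D.deg := by rw [hF, hr, ← pow_mul, hdeg]
  have hcard : Nat.card E = D.p ^ D.deg := by
    rw [Module.natCard_eq_pow_finrank (K := F), hE, hcardF]
  have hpos : 0 < D.p ^ D.deg := pow_pos hp.pos _
  have hord : D.p ^ D.deg - 1 = D.order := rfl
  have hcheck' := Bool.and_eq_true_iff.1 hcheck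
  obtain ⟨z, hz⟩ := exists_isZechRoot hcheck'.1 hp E hcard
  refine hasMutuallyOrthogovalPG_of_preservesNoTriple (w := w) hd hE
    (by rw [hcard, hord]; exact hz.isPrimitiveRoot) (by rwa [hcardF, hord]) fun k hk hkn => ?_
  exact hz.preservesNoTriple hp (by omega) hF hN (validTables_of_checkTables hcheck'.1).order_le
    hcheck'.2 hk (by omega)

end Orthogoval

theorem mainTheorem11 (F : Type*) [Field F] :
    (Nat.card F = 2 →
      Orthogoval.HasMutuallyOrthogovalPG 4 F 6 ∧ Orthogoval.HasMutuallyOrthogovalPG 6 F 18) ∧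
    (Nat.card F = 3 →
      Orthogoval.HasMutuallyOrthogovalPG 4 F 10 ∧ Orthogoval.HasMutuallyOrthogovalPG 6 F 78) ∧
    (Nat.card F = 4 →
      Orthogoval.HasMutuallyOrthogovalPG 4 F 3 ∧ Orthogoval.HasMutuallyOrthogovalPG 6 F 11) ∧
    (Nat.card F = 5 → Orthogoval.HasMutuallyOrthogovalPG 4 F 7) := by
  refine ⟨fun h => ⟨?_, ?_⟩, fun h => ⟨?_, ?_⟩, fun h => ⟨?_, ?_⟩, fun h => ?_⟩
  -- The digits 101 of `red = 5` encode z^5 = z^2 + 1; `half` is 0 in characteristic 2, where -1 =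
  -- 1. The last argument is one less than the number of spaces. Powers of 3 give no more here: 3^6
  -- ≡ 2^4 modulo 31 acts as a Frobenius map, a collineation; likewise 3^18 ≡ 2^2 modulo 127 in the
  -- next case.
  · exact Orthogoval.FieldData.hasMutuallyOrthogovalPG ⟨2, 5, 5, 3, 5, 0⟩ 31 1 3 5
      (by decide +kernel) (by decide) (by decide) (by decide) h (k := 1) rfl (by decide) rfl
  · exact Orthogoval.FieldData.hasMutuallyOrthogovalPG ⟨2, 7, 3, 2, 7, 0⟩ 127 1 3 17
      (by decide +kernel) (by decide) (by decide) (by decide) h (k := 1) rfl (by decide) rfl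
  · exact Orthogoval.FieldData.hasMutuallyOrthogovalPG ⟨3, 5, 5, 3, 8, 121⟩ 121 2 17 9
      (by decide +kernel) (by decide) (by decide) (by decide) h (k := 1) rfl (by decide) rfl
  · exact Orthogoval.FieldData.hasMutuallyOrthogovalPG ⟨3, 7, 23, 3, 12, 1093⟩ 1093 2 25 77
      (by decide +kernel) (by decide) (by decide) (by decide) h (k := 1) rfl (by decide) rfl
  -- For q = 4 the extension is coded over the prime field, with degree 2(d + 1); 𝔽_4 enters only
  -- through `r = 3` and the number of points.
  · exact Orthogoval.FieldData.hasMutuallyOrthogovalPG ⟨2, 10, 9, 4, 10, 0⟩ 341 3 7 2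
      (by decide +kernel) (by decide) (by decide) (by decide) h (k := 2) rfl (by decide) rfl
  · exact Orthogoval.FieldData.hasMutuallyOrthogovalPG ⟨2, 14, 43, 6, 14, 0⟩ 5461 3 23 10
      (by decide +kernel) (by decide) (by decide) (by decide) h (k := 2) rfl (by decide) rfl
  · exact Orthogoval.FieldData.hasMutuallyOrthogovalPG ⟨5, 5, 8, 3, 12, 1562⟩ 781 4 3 6
      (by decide +kernel) (by decide) (by decide) (by decide) h (k := 1) rfl (by decide) rfl
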